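/- **Setting.** Fix $n\ge 1$ and $0<\gamma<1$; functions are real- or complex-valued. Cubes $Q\subset\mathbb R^n$ have sides parallel to the axes, and $2^mQ$ is the cube with the same center as $Q$ and $2^m$ times its side length. A *Young function* is a continuous nondecreasing $A:[0,\infty)\to[0,\infty)$ with $A(0)=0$ such that either $A$ is convex and $A(t)\to\infty$ as $t\to\infty$, or $A(t)/t\to\infty$ as $t\to\infty$; its conjugate is $\overline A(t)=\sup_{u\ge0}(ut-A(u))\in[0,\infty]$. For $\Phi=A$ or $\Phi=\overline A$ put $$\|f\|_{L^\Phi(Q)}=\inf\Big\{\lambda>0:\frac1{|Q|}\int_Q\Phi\Big(\frac{|f(y)|}\lambda\Big)\,dy\le1\Big\},\qquad M_{\gamma,\Phi}f(x)=\sup_{Q\ni x}|Q|^\gamma\|f\|_{L^\Phi(Q)},$$ and for $0<s\le 1/2$, a cube $Q_0$ and $x\in Q_0$ put $$M^\sharp_{0,s,Q_0}g(x)=\sup_{x\in Q,\,Q\subset Q_0}\ \inf_c\ \inf\{\alpha\ge0:|\{y\in Q:|g(y)-c|>\alpha\}|<s|Q|\},$$ where $c$ ranges over the scalars. **Theorem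 2.2.** Let $k(x,y)$ be a measurable kernel on $\mathbb R^n\times\mathbb R^n$ and $Tf(x)=\int_{\mathbb R^n}k(x,y)f(y)\,dy$, defined for those measurable $f$ for which the integral converges absolutely for almost every $x$. Suppose that $T$ is of weak type $(1,1/(1-\gamma))$, i.e. there is a constant $C$ with $$t\,|\{x:|Tf(x)|>t\}|^{1-\gamma}\le C\|f\|_{L^1}$$ for all $t>0$ and all $f\in L^1(\mathbb R^n)$ for which $Tf$ is defined, and that for a Young function $A$ there is a constant $c_A<\infty$ such that for every cube $Q$ and all $u,v\in Q$, $$\sum_{m=1}^\infty|2^{m+1}Q|^{1-\gamma}\,\big\|\mathbf 1_{2^{m+1}Q\setminus2^mQ}\,(k(u,\cdot)-k(v,\cdot))\big\|_{L^A(2^{m+1}Q)}\le c_A .$$ Then for every $0<s\le1/2$ there is a constant $c<\infty$, independent of $f$, $Q_0$ and $x$, such that for every $f$ for which $Tf$ is defined, every cube $Q_0$ and every $x\in Q_0$, $$M^\sharp_{0,s,Q_0}(Tf)(x)\le c\,\sup_{x\in Q,\,Q\subset Q_0}\ \inf_{y\in Q}M_{\gamma,\overline A}f(y).$$ -/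

import Mathlib

open MeasureTheory Filter
open scoped NNReal ENNReal Topology

noncomputable section

namespace FracInt

/-- A (nondegenerate, closed) cube of `ℝⁿ` with sides parallel to the axes, given by its center
and half of its side length. -/
structure Cube (n : ℕ) where
  center : Fin n → ℝ
  halfSide : ℝ
  halfSide_pos : 0 < halfSide

namespace Cube

variable {n : ℕ}

/-- The set of points of a cube. -/
def toSet (Q : Cube n) : Set (Fin n → ℝ) :=
  {y | ∀ i, |y i - Q.center i| ≤ Q.halfSide}

/-- The cube `2 ^ j Q`: same center as `Q`, side length multiplied by `2 ^ j`. -/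
def dyadicDilate (Q : Cube n) (j : ℕ) : Cube n where
  center := Q.center
  halfSide := 2 ^ j * Q.halfSide
  halfSide_pos := mul_pos (pow_pos two_pos j) Q.halfSide_pos

end Cube

/-- Young functions on `[0, ∞)`. Neither strict monotonicity nor the doubling condition
`A (2 t) ≤ c A t` is required. -/
structure IsYoung (A : ℝ≥0 → ℝ≥0) : Prop where
  continuous : Continuous A
  monotone : Monotone A
  map_zero : A 0 = 0
  growth : (ConvexOn ℝ≥0 Set.univ A ∧ Tendsto A atTop atTop) ∨
    Tendsto (fun t => A t / t) atTop atTop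

/-- The conjugate function `Ā t = sup_{u ≥ 0} (u t - A u)`, with values in `[0, ∞]`. The
subtraction is truncated at `0`, which does not change the supremum when `A 0 = 0`, because
`u = 0` contributes `0`. -/
def conjugate (A : ℝ≥0 → ℝ≥0) (t : ℝ≥0) : ℝ≥0∞ :=
  ⨆ u : ℝ≥0, ((u : ℝ≥0∞) * (t : ℝ≥0∞) - (A u : ℝ≥0∞))

section Functionals

variable {n : ℕ} {𝕜 : Type*} [RCLike 𝕜]

/-- The averaged Luxemburg functional `‖f‖_{L^Φ(Q)}`, the infimum of the `lam > 0` for which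
`|Q|⁻¹ ∫_Q Φ (|f| / lam) ≤ 1`; it is `∞` if there is no such `lam`. -/
def luxNorm (Φ : ℝ≥0 → ℝ≥0∞) (f : (Fin n → ℝ) → 𝕜) (Q : Cube n) : ℝ≥0∞ :=
  ⨅ (lam : ℝ≥0) (_ : 0 < lam)
    (_ : (volume Q.toSet)⁻¹ * ∫⁻ y in Q.toSet, Φ (‖f y‖₊ / lam) ≤ 1), (lam : ℝ≥0∞)

/-- The fractional maximal function
`M_{γ,Φ} f (x) = sup_{Q ∋ x} |Q| ^ γ ‖f‖_{L^Φ(Q)}`, over all cubes `Q` containing `x`. -/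
def fracMaximal (γ : ℝ) (Φ : ℝ≥0 → ℝ≥0∞) (f : (Fin n → ℝ) → 𝕜) (x : Fin n → ℝ) : ℝ≥0∞ :=
  ⨆ (Q : Cube n) (_ : x ∈ Q.toSet), volume Q.toSet ^ γ * luxNorm Φ f Q

/-- The local sharp maximal function restricted to the cube `Q₀`,
`sup_{x ∈ Q ⊆ Q₀} inf_c inf {α ≥ 0 : |{y ∈ Q : |f y - c| > α}| < s |Q|}`. -/
def localSharp (s : ℝ) (Q₀ : Cube n) (f : (Fin n → ℝ) → 𝕜) (x : Fin n → ℝ) : ℝ≥0∞ :=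
  ⨆ (Q : Cube n) (_ : x ∈ Q.toSet) (_ : Q.toSet ⊆ Q₀.toSet),
    ⨅ (c : 𝕜) (α : ℝ≥0)
      (_ : volume {y | y ∈ Q.toSet ∧ (α : ℝ) < ‖f y - c‖} < ENNReal.ofReal s * volume Q.toSet),
      (α : ℝ≥0∞)

/-- The integral operator `T f (x) = ∫ k(x, y) f(y) dy`. -/
def intOp (k : (Fin n → ℝ) → (Fin n → ℝ) → 𝕜) (f : (Fin n → ℝ) → 𝕜) (x : Fin n → ℝ) : 𝕜 :=
  ∫ y, k x y * f y

/-- `f` lies in the natural domain of the integral operator with kernel `k`: it is measurable, and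
the integral defining `T f (x)` converges absolutely for almost every `x`. -/
def InDomain (k : (Fin n → ℝ) → (Fin n → ℝ) → 𝕜) (f : (Fin n → ℝ) → 𝕜) : Prop :=
  AEStronglyMeasurable f volume ∧ ∀ᵐ x, Integrable (fun y => k x y * f y) volume

/-- The integral operator with kernel `k` is of weak type `(p, q)`: there is a constant `C` with
`t |{|T f| > t}| ^ (1 / q) ≤ C ‖f‖_p` for all `t > 0` and all `f ∈ L ^ p` for which `T f` is
defined. -/
def IsWeakType (k : (Fin n → ℝ) → (Fin n → ℝ) → 𝕜) (p : ℝ≥0∞) (q : ℝ) : Prop :=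
  ∃ C : ℝ≥0, ∀ f : (Fin n → ℝ) → 𝕜, InDomain k f → MemLp f p volume →
    ∀ t : ℝ≥0, 0 < t →
      (t : ℝ≥0∞) * volume {x | (t : ℝ) < ‖intOp k f x‖} ^ (1 / q) ≤ C * eLpNorm f p volume

/-- The `L^A` Hörmander-type condition of order `γ`: there is a finite constant `c` such that, for
every cube `Q` and all `u, v ∈ Q`,
`∑_{m ≥ 1} |2^{m+1}Q|^{1-γ} ‖1_{2^{m+1}Q \ 2^m Q} (k(u, ·) - k(v, ·))‖_{L^A(2^{m+1}Q)} ≤ c`.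
The sum is indexed from `0`, the index `j` standing for `m = j + 1`. -/
def IsHormander (γ : ℝ) (A : ℝ≥0 → ℝ≥0) (k : (Fin n → ℝ) → (Fin n → ℝ) → 𝕜) : Prop :=
  ∃ c : ℝ≥0, ∀ Q : Cube n, ∀ u ∈ Q.toSet, ∀ v ∈ Q.toSet,
    ∑' j : ℕ, volume (Q.dyadicDilate (j + 2)).toSet ^ (1 - γ) *
      luxNorm (fun t => (A t : ℝ≥0∞))
        (((Q.dyadicDilate (j + 2)).toSet \ (Q.dyadicDilate (j + 1)).toSet).indicator
          (fun y => k u y - k v y))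
        (Q.dyadicDilate (j + 2)) ≤ c

end Functionals

end FracInt

end

open FracInt

namespace FracInt

variable {n : ℕ} {𝕜 : Type*} [RCLike 𝕜]

namespace Cube

/-! Fix a cube `Q` with `x ∈ Q ⊆ Q₀`, a point `y ∈ Q` and a number `M > 0` exceeding the maximal
function of `f` at `y`, and split `f` at `2Q`. Local part: Hölder against the constant `1` bounds
the `L¹` norm of `f` on `2Q` by a multiple of `M |Q|^(1-γ)`, so the weak type bound makes `|T(f
1_{2Q})| > K M` a set of measure less than `s |Q|` (`exists_volume_intOp_indicator_lt`). Far part: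
take for the constant its value at one good point `u ∈ Q`. On each shell `2^{m+1}Q \ 2^m Q`, Hölder
for `A` and its conjugate costs `2 M` times one term of the Hörmander sum, so the far part varies by
at most `2 M c_A` over almost all of `Q` (`lintegral_compl_kernel_sub_le`). Hence `α = (K + 2 c_A)
M` is admissible. -/

theorem toSet_eq_closedBall (Q : Cube n) : Q.toSet = Metric.closedBall Q.center Q.halfSide := by
  ext y
  simp [toSet, Metric.mem_closedBall, dist_pi_le_iff Q.halfSide_pos.le, Real.dist_eq]

theorem measurableSet_toSet (Q : Cube n) : MeasurableSet Q.toSet := by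
  rw [toSet_eq_closedBall]; exact Metric.isClosed_closedBall.measurableSet

theorem volume_toSet (Q : Cube n) : volume Q.toSet = ENNReal.ofReal ((2 * Q.halfSide) ^ n) := by
  rw [toSet_eq_closedBall, Real.volume_pi_closedBall _ Q.halfSide_pos.le, Fintype.card_fin]

theorem volume_toSet_ne_zero (Q : Cube n) : volume Q.toSet ≠ 0 := by
  have := Q.halfSide_pos
  rw [volume_toSet, Ne, ENNReal.ofReal_eq_zero, not_le]; positivity

theorem volume_toSet_ne_top (Q : Cube n) : volume Q.toSet ≠ ⊤ := by
  rw [volume_toSet]; exact ENNReal.ofReal_ne_top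

theorem volume_dyadicDilate (Q : Cube n) (j : ℕ) :
    volume (Q.dyadicDilate j).toSet = (2 ^ j) ^ n * volume Q.toSet := by
  have := Q.halfSide_pos
  rw [volume_toSet, volume_toSet]
  have h : (2 * (Q.dyadicDilate j).halfSide) ^ n = (2 ^ j) ^ n * (2 * Q.halfSide) ^ n := by
    simp only [dyadicDilate]; rw [← mul_pow]; ring
  rw [h, ENNReal.ofReal_mul (by positivity), ENNReal.ofReal_pow (by positivity),
    ENNReal.ofReal_pow (by positivity)]
  simp

theorem subset_dyadicDilate (Q : Cube n) (j : ℕ) : Q.toSet ⊆ (Q.dyadicDilate j).toSet := by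
  intro y hy i
  refine (hy i).trans ?_
  exact le_mul_of_one_le_left Q.halfSide_pos.le (one_le_pow₀ one_le_two)

theorem compl_dyadicDilate_one_subset (Q : Cube n) :
    (Q.dyadicDilate 1).toSetᶜ ⊆
      ⋃ j : ℕ, (Q.dyadicDilate (j + 2)).toSet \ (Q.dyadicDilate (j + 1)).toSet := by
  classical
  intro y hy
  have hex : ∃ j : ℕ, y ∈ (Q.dyadicDilate (j + 1)).toSet := by
    obtain ⟨m, hm⟩ := pow_unbounded_of_one_lt (dist y Q.center / Q.halfSide) one_lt_two
    refine ⟨m, ?_⟩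
    rw [toSet_eq_closedBall, Metric.mem_closedBall]
    rw [div_lt_iff₀ Q.halfSide_pos] at hm
    refine hm.le.trans ?_
    exact mul_le_mul_of_nonneg_right (pow_le_pow_right₀ one_le_two (by omega)) Q.halfSide_pos.le
  obtain ⟨j, hj, hmin⟩ : ∃ j, y ∈ (Q.dyadicDilate (j + 1)).toSet ∧
      ∀ i < j, y ∉ (Q.dyadicDilate (i + 1)).toSet :=
    ⟨Nat.find hex, Nat.find_spec hex, fun i hi => Nat.find_min hex hi⟩
  -- Least index `0` would put `y` in `2Q`, so the least index is a successor and `y` lies in the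
  -- corresponding shell.
  rcases j with _ | j
  · exact absurd hj hy
  · exact Set.mem_iUnion.2 ⟨j, hj, hmin j (Nat.lt_succ_self j)⟩

end Cube

/-! ### Young and Hölder inequalities for the Luxemburg functionals. -/

/-- Young's inequality. -/
theorem mul_le_add_conjugate (A : ℝ≥0 → ℝ≥0) (u t : ℝ≥0) :
    (u : ℝ≥0∞) * t ≤ A u + conjugate A t := by
  rw [add_comm, ← tsub_le_iff_right]
  exact le_iSup (fun u : ℝ≥0 => (u : ℝ≥0∞) * (t : ℝ≥0∞) - (A u : ℝ≥0∞)) u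

theorem exists_feasible_of_luxNorm_lt {Φ : ℝ≥0 → ℝ≥0∞} {f : (Fin n → ℝ) → 𝕜} {Q : Cube n}
    {a : ℝ≥0∞} (h : luxNorm Φ f Q < a) :
    ∃ lam : ℝ≥0, 0 < lam ∧ ∫⁻ y in Q.toSet, Φ (‖f y‖₊ / lam) ≤ volume Q.toSet ∧
      (lam : ℝ≥0∞) < a := by
  simp only [luxNorm, iInf_lt_iff] at h
  obtain ⟨lam, h0, h1, h2⟩ := h
  refine ⟨lam, h0, ?_, h2⟩
  rwa [mul_comm, ← div_eq_mul_inv,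
    ENNReal.div_le_iff Q.volume_toSet_ne_zero Q.volume_toSet_ne_top, one_mul] at h1

/-- Hölder's inequality for the Luxemburg functionals of a function and its conjugate. -/
theorem lintegral_mul_le_luxNorm_mul_luxNorm {A : ℝ≥0 → ℝ≥0} (hA : Continuous A) {Q : Cube n}
    {g f : (Fin n → ℝ) → 𝕜} (hg : AEStronglyMeasurable g volume)
    (hgt : luxNorm (fun t => (A t : ℝ≥0∞)) g Q ≠ ⊤) (hft : luxNorm (conjugate A) f Q ≠ ⊤) :
    ∫⁻ y in Q.toSet, ‖g y‖ₑ * ‖f y‖ₑ ≤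
      2 * volume Q.toSet *
        (luxNorm (fun t => (A t : ℝ≥0∞)) g Q * luxNorm (conjugate A) f Q) := by
  -- The infima need not be attained, so the bound is proved for strictly larger `a`, `b`, which are
  -- then lowered to the norms.
  have key : ∀ a > luxNorm (fun t => (A t : ℝ≥0∞)) g Q, ∀ b > luxNorm (conjugate A) f Q,
      ∫⁻ y in Q.toSet, ‖g y‖ₑ * ‖f y‖ₑ ≤ 2 * volume Q.toSet * (a * b) := by
    intro a ha b hb
    obtain ⟨l, l0, hl, hla⟩ := exists_feasible_of_luxNorm_lt ha
    obtain ⟨r, r0, hr, hrb⟩ := exists_feasible_of_luxNorm_lt hb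
    have hpt : ∀ y, ‖g y‖ₑ * ‖f y‖ₑ ≤
        (l * r : ℝ≥0) * ((A (‖g y‖₊ / l) : ℝ≥0∞) + conjugate A (‖f y‖₊ / r)) := by
      intro y
      have e : ‖g y‖ₑ * ‖f y‖ₑ = (l * r : ℝ≥0) *
          (((‖g y‖₊ / l : ℝ≥0) : ℝ≥0∞) * ((‖f y‖₊ / r : ℝ≥0) : ℝ≥0∞)) := by
        rw [enorm_eq_nnnorm, enorm_eq_nnnorm]
        norm_cast
        field_simp
      rw [e]
      gcongr
      exact mul_le_add_conjugate _ _ _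
    have hmeas : AEMeasurable (fun y => (A (‖g y‖₊ / l) : ℝ≥0∞)) (volume.restrict Q.toSet) := by
      have h1 : AEMeasurable (fun y => ‖g y‖₊ / l) (volume.restrict Q.toSet) :=
        (hg.restrict.nnnorm.aemeasurable).div_const l
      exact (hA.measurable.comp_aemeasurable h1).coe_nnreal_ennreal
    calc ∫⁻ y in Q.toSet, ‖g y‖ₑ * ‖f y‖ₑ
        ≤ ∫⁻ y in Q.toSet, (l * r : ℝ≥0) *
          ((A (‖g y‖₊ / l) : ℝ≥0∞) + conjugate A (‖f y‖₊ / r)) := lintegral_mono hpt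
      _ = (l * r : ℝ≥0) * ((∫⁻ y in Q.toSet, (A (‖g y‖₊ / l) : ℝ≥0∞)) +
          ∫⁻ y in Q.toSet, conjugate A (‖f y‖₊ / r)) := by
        -- Additivity needs measurability of the `A` term only; nothing is asked of `f` or of the
        -- conjugate.
        rw [lintegral_const_mul' _ _ ENNReal.coe_ne_top, lintegral_add_left' hmeas]
      _ ≤ (l * r : ℝ≥0) * (volume Q.toSet + volume Q.toSet) := by gcongr
      _ = 2 * volume Q.toSet * (l * r) := by push_cast; ring
      _ ≤ 2 * volume Q.toSet * (a * b) := by gcongr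
  set x := luxNorm (fun t => (A t : ℝ≥0∞)) g Q
  set z := luxNorm (conjugate A) f Q
  have htend : Tendsto (fun ε : ℝ≥0∞ => 2 * volume Q.toSet * ((x + ε) * (z + ε))) (𝓝[>] 0)
      (𝓝 (2 * volume Q.toSet * (x * z))) := by
    have hx : Tendsto (fun ε : ℝ≥0∞ => x + ε) (𝓝[>] 0) (𝓝 x) := by
      have : Tendsto (fun ε : ℝ≥0∞ => x + ε) (𝓝 0) (𝓝 (x + 0)) :=
        (continuous_const.add continuous_id).tendsto 0
      rw [add_zero] at this
      exact this.mono_left nhdsWithin_le_nhds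
    have hz : Tendsto (fun ε : ℝ≥0∞ => z + ε) (𝓝[>] 0) (𝓝 z) := by
      have : Tendsto (fun ε : ℝ≥0∞ => z + ε) (𝓝 0) (𝓝 (z + 0)) :=
        (continuous_const.add continuous_id).tendsto 0
      rw [add_zero] at this
      exact this.mono_left nhdsWithin_le_nhds
    exact ENNReal.Tendsto.const_mul (ENNReal.Tendsto.mul hx (Or.inr hft) hz (Or.inr hgt))
      (Or.inr (ENNReal.mul_ne_top ENNReal.ofNat_ne_top Q.volume_toSet_ne_top))
  refine ge_of_tendsto htend ?_
  filter_upwards [self_mem_nhdsWithin] with ε hε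
  exact key _ (ENNReal.lt_add_right hgt (ne_of_gt hε)) _ (ENNReal.lt_add_right hft (ne_of_gt hε))

/-- Any `t > 0` with `A t < 1` makes `t⁻¹` admissible for all cubes at once. Pairing `f` with `1`
then controls its `L¹` mean. -/
theorem exists_luxNorm_one_le {A : ℝ≥0 → ℝ≥0} (hA : Continuous A) (h0 : A 0 = 0) (n : ℕ)
    (𝕜 : Type*) [RCLike 𝕜] :
    ∃ l : ℝ≥0, ∀ Q : Cube n,
      luxNorm (fun t => (A t : ℝ≥0∞)) (fun _ => (1 : 𝕜)) Q ≤ l := by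
  have h1 : ∀ᶠ t in 𝓝[>] (0 : ℝ≥0), A t < 1 := by
    refine (hA.tendsto 0).mono_left nhdsWithin_le_nhds |>.eventually_lt_const ?_
    rw [h0]; exact one_pos
  obtain ⟨t, ht1, ht0⟩ := (h1.and self_mem_nhdsWithin).exists
  have ht0 : 0 < t := ht0
  refine ⟨t⁻¹, fun Q => ?_⟩
  refine iInf_le_of_le t⁻¹ (iInf_le_of_le (by positivity) (iInf_le_of_le ?_ le_rfl))
  simp only [nnnorm_one, one_div, inv_inv, lintegral_const, Measure.restrict_apply,
    MeasurableSet.univ, Set.univ_inter]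
  rw [mul_left_comm, ENNReal.inv_mul_cancel Q.volume_toSet_ne_zero Q.volume_toSet_ne_top, mul_one]
  exact_mod_cast ht1.le

theorem luxNorm_le_of_fracMaximal_le {γ : ℝ} {Φ : ℝ≥0 → ℝ≥0∞} {f : (Fin n → ℝ) → 𝕜}
    {y : Fin n → ℝ} {Q : Cube n} (hy : y ∈ Q.toSet) {M : ℝ≥0∞} (hM : fracMaximal γ Φ f y ≤ M) :
    volume Q.toSet ^ γ * luxNorm Φ f Q ≤ M :=
  (le_iSup₂ (f := fun (Q : Cube n) (_ : y ∈ Q.toSet) => volume Q.toSet ^ γ * luxNorm Φ f Q)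
    Q hy).trans hM

namespace Cube

theorem rpow_volume_ne_zero (Q : Cube n) (γ : ℝ) : volume Q.toSet ^ γ ≠ 0 :=
  (ENNReal.rpow_pos (pos_iff_ne_zero.2 Q.volume_toSet_ne_zero) Q.volume_toSet_ne_top).ne'

theorem rpow_one_sub_mul_rpow (Q : Cube n) (γ : ℝ) :
    volume Q.toSet ^ (1 - γ) * volume Q.toSet ^ γ = volume Q.toSet := by
  rw [← ENNReal.rpow_add _ _ Q.volume_toSet_ne_zero Q.volume_toSet_ne_top, sub_add_cancel,
    ENNReal.rpow_one]

end Cube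

/-- Hölder's inequality with the fractional maximal function on one side. -/
theorem lintegral_mul_le_of_fracMaximal_le {A : ℝ≥0 → ℝ≥0} (hA : Continuous A) {γ : ℝ}
    {Q : Cube n} {g f : (Fin n → ℝ) → 𝕜} (hg : AEStronglyMeasurable g volume)
    (hgt : luxNorm (fun t => (A t : ℝ≥0∞)) g Q ≠ ⊤) {y : Fin n → ℝ} (hy : y ∈ Q.toSet)
    {M : ℝ≥0} (hM : fracMaximal γ (conjugate A) f y ≤ M) :
    ∫⁻ y in Q.toSet, ‖g y‖ₑ * ‖f y‖ₑ ≤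
      2 * M * (volume Q.toSet ^ (1 - γ) * luxNorm (fun t => (A t : ℝ≥0∞)) g Q) := by
  have hle := luxNorm_le_of_fracMaximal_le hy hM
  have hft : luxNorm (conjugate A) f Q ≠ ⊤ := by
    intro h
    rw [h, ENNReal.mul_top (Q.rpow_volume_ne_zero γ)] at hle
    exact ENNReal.coe_ne_top (top_le_iff.1 hle)
  calc ∫⁻ y in Q.toSet, ‖g y‖ₑ * ‖f y‖ₑ
      ≤ 2 * volume Q.toSet *
        (luxNorm (fun t => (A t : ℝ≥0∞)) g Q * luxNorm (conjugate A) f Q) :=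
        lintegral_mul_le_luxNorm_mul_luxNorm hA hg hgt hft
    _ = 2 * (volume Q.toSet ^ γ * luxNorm (conjugate A) f Q) *
        (volume Q.toSet ^ (1 - γ) * luxNorm (fun t => (A t : ℝ≥0∞)) g Q) := by
        -- Splitting `|Q| = |Q|^(1-γ) |Q|^γ` gives `f` the maximal function's weight and `g` the
        -- Hörmander weight.
        conv_lhs => rw [← Q.rpow_one_sub_mul_rpow γ]
        ring
    _ ≤ _ := by gcongr

/-! ### The far and local parts of `T f`. -/

/-- The oscillation of the far part of `T f` on a cube. -/
theorem lintegral_compl_kernel_sub_le {A : ℝ≥0 → ℝ≥0} (hA : Continuous A) {γ : ℝ}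
    {k : (Fin n → ℝ) → (Fin n → ℝ) → 𝕜} {c : ℝ≥0} {Q : Cube n} {u v : Fin n → ℝ}
    (hsum : ∑' j : ℕ, volume (Q.dyadicDilate (j + 2)).toSet ^ (1 - γ) *
      luxNorm (fun t => (A t : ℝ≥0∞))
        (((Q.dyadicDilate (j + 2)).toSet \ (Q.dyadicDilate (j + 1)).toSet).indicator
          (fun y => k u y - k v y))
        (Q.dyadicDilate (j + 2)) ≤ c)
    (hu : AEStronglyMeasurable (k u) volume) (hv : AEStronglyMeasurable (k v) volume)
    {f : (Fin n → ℝ) → 𝕜} {y : Fin n → ℝ} (hy : y ∈ Q.toSet)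
    {M : ℝ≥0} (hM : fracMaximal γ (conjugate A) f y ≤ M) :
    ∫⁻ z in (Q.dyadicDilate 1).toSetᶜ, ‖k u z - k v z‖ₑ * ‖f z‖ₑ ≤ 2 * M * c := by
  set S : ℕ → Set (Fin n → ℝ) :=
    fun j => (Q.dyadicDilate (j + 2)).toSet \ (Q.dyadicDilate (j + 1)).toSet with hS
  have hSm : ∀ j, MeasurableSet (S j) := fun j =>
    (Cube.measurableSet_toSet _).diff (Cube.measurableSet_toSet _)
  have hterm : ∀ j, ∫⁻ z in S j, ‖k u z - k v z‖ₑ * ‖f z‖ₑ ≤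
      2 * M * (volume (Q.dyadicDilate (j + 2)).toSet ^ (1 - γ) *
      luxNorm (fun t => (A t : ℝ≥0∞)) ((S j).indicator (fun y => k u y - k v y))
        (Q.dyadicDilate (j + 2))) := by
    intro j
    have hfin : luxNorm (fun t => (A t : ℝ≥0∞)) ((S j).indicator (fun y => k u y - k v y))
        (Q.dyadicDilate (j + 2)) ≠ ⊤ := by
      intro h
      have h1 := (ENNReal.le_tsum j).trans hsum
      change _ * luxNorm _ ((S j).indicator _) _ ≤ _ at h1
      rw [h, ENNReal.mul_top (Cube.rpow_volume_ne_zero _ _)] at h1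
      exact ENNReal.coe_ne_top (top_le_iff.1 h1)
    refine le_trans ?_ (lintegral_mul_le_of_fracMaximal_le hA
      ((hu.sub hv).indicator (hSm j)) hfin (Q.subset_dyadicDilate _ hy) hM)
    calc ∫⁻ z in S j, ‖k u z - k v z‖ₑ * ‖f z‖ₑ
        = ∫⁻ z in S j, ‖(S j).indicator (fun y => k u y - k v y) z‖ₑ * ‖f z‖ₑ :=
          setLIntegral_congr_fun (hSm j) fun z hz => by simp only [Set.indicator_of_mem hz]
      _ ≤ _ := lintegral_mono_set Set.sdiff_subset
  calc ∫⁻ z in (Q.dyadicDilate 1).toSetᶜ, ‖k u z - k v z‖ₑ * ‖f z‖ₑ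
      ≤ ∫⁻ z in ⋃ j, S j, ‖k u z - k v z‖ₑ * ‖f z‖ₑ :=
        lintegral_mono_set Q.compl_dyadicDilate_one_subset
    _ ≤ ∑' j, ∫⁻ z in S j, ‖k u z - k v z‖ₑ * ‖f z‖ₑ := lintegral_iUnion_le _ _
    _ ≤ ∑' j, 2 * M * (volume (Q.dyadicDilate (j + 2)).toSet ^ (1 - γ) *
      luxNorm (fun t => (A t : ℝ≥0∞)) ((S j).indicator (fun y => k u y - k v y))
        (Q.dyadicDilate (j + 2))) := ENNReal.tsum_le_tsum hterm
    _ ≤ 2 * M * c := by rw [ENNReal.tsum_mul_left]; gcongr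

theorem InDomain.indicator {k : (Fin n → ℝ) → (Fin n → ℝ) → 𝕜} {f : (Fin n → ℝ) → 𝕜}
    (hf : InDomain k f) {S : Set (Fin n → ℝ)} (hS : MeasurableSet S) :
    InDomain k (S.indicator f) := by
  refine ⟨hf.1.indicator hS, hf.2.mono fun x hx => ?_⟩
  simpa only [← Set.indicator_mul_right] using hx.indicator hS

theorem intOp_indicator_add_compl {k : (Fin n → ℝ) → (Fin n → ℝ) → 𝕜} {f : (Fin n → ℝ) → 𝕜}
    {x : Fin n → ℝ} (hx : Integrable (fun y => k x y * f y) volume) {S : Set (Fin n → ℝ)}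
    (hS : MeasurableSet S) :
    intOp k f x = intOp k (S.indicator f) x + ∫ y in Sᶜ, k x y * f y := by
  rw [intOp, intOp, ← integral_add_compl hS hx, ← integral_indicator hS]
  simp only [Set.indicator_mul_right]

/-- The weak type bound for the local part of `T f` on a cube. -/
theorem exists_volume_intOp_indicator_lt {γ : ℝ} (hγ1 : γ < 1) {A : ℝ≥0 → ℝ≥0}
    (hA : IsYoung A) {k : (Fin n → ℝ) → (Fin n → ℝ) → 𝕜} (hweak : IsWeakType k 1 (1 / (1 - γ)))
    {s : ℝ} (hs : 0 < s) :
    ∃ K : ℝ≥0, 0 < K ∧ ∀ f : (Fin n → ℝ) → 𝕜, InDomain k f → ∀ Q : Cube n, ∀ y ∈ Q.toSet,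
      ∀ M : ℝ≥0, 0 < M → fracMaximal γ (conjugate A) f y ≤ M →
        volume {x | ((K * M : ℝ≥0) : ℝ) < ‖intOp k ((Q.dyadicDilate 1).toSet.indicator f) x‖} <
          ENNReal.ofReal s * volume Q.toSet := by
  obtain ⟨C, hC⟩ := hweak
  obtain ⟨l, hl⟩ := exists_luxNorm_one_le hA.continuous hA.map_zero n 𝕜
  have hγ : 0 < 1 - γ := sub_pos.2 hγ1
  -- Weak type constant, Hölder's `2`, the ratio `(|2Q| / |Q|)^(1-γ)`, and the norm bound of `1`.
  set D : ℝ≥0 := C * (2 * ((2 ^ n) ^ (1 - γ) * l)) with hD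
  set σ : ℝ≥0 := s.toNNReal ^ (1 - γ) with hσ
  have hσ0 : 0 < σ := NNReal.rpow_pos (Real.toNNReal_pos.2 hs)
  have hK0 : 0 < (D + 1) / σ := by positivity
  -- The `+ 1` yields the strict inequality: if it failed, the weak type bound would give `(D + 1) M
  -- ≤ D M` with `M > 0`.
  refine ⟨(D + 1) / σ, hK0, fun f hf Q y hy M hM0 hM => ?_⟩
  set Q' := Q.dyadicDilate 1
  have hint : ∫⁻ z in Q'.toSet, ‖f z‖ₑ ≤
      2 * M * (volume Q'.toSet ^ (1 - γ) * l) := by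
    have h1 : luxNorm (fun t => (A t : ℝ≥0∞)) (fun _ : Fin n → ℝ => (1 : 𝕜)) Q' ≠ ⊤ :=
      ne_top_of_le_ne_top ENNReal.coe_ne_top (hl Q')
    have h2 := lintegral_mul_le_of_fracMaximal_le hA.continuous (γ := γ) (f := f)
      aestronglyMeasurable_const h1 (Q.subset_dyadicDilate 1 hy) hM
    simp only [enorm_one, one_mul] at h2
    refine h2.trans ?_
    gcongr
    exact hl Q'
  have hnorm : eLpNorm (Q'.toSet.indicator f) 1 volume = ∫⁻ z in Q'.toSet, ‖f z‖ₑ := by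
    rw [eLpNorm_one_eq_lintegral_enorm, ← lintegral_indicator Q'.measurableSet_toSet]
    simp only [enorm_indicator_eq_indicator_enorm]
  have hdom := hf.indicator Q'.measurableSet_toSet
  have hLp : MemLp (Q'.toSet.indicator f) 1 volume := by
    refine ⟨hdom.1, ?_⟩
    rw [hnorm]
    refine hint.trans_lt ?_
    have : volume Q'.toSet ^ (1 - γ) ≠ ⊤ :=
      ENNReal.rpow_ne_top_of_nonneg hγ.le Q'.volume_toSet_ne_top
    finiteness
  have hw := hC _ hdom hLp ((D + 1) / σ * M) (by positivity)
  rw [one_div_one_div, hnorm] at hw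
  by_contra! hcon
  have hvol0 : volume Q.toSet ^ (1 - γ) ≠ 0 := Q.rpow_volume_ne_zero _
  have hvolt : volume Q.toSet ^ (1 - γ) ≠ ⊤ :=
    ENNReal.rpow_ne_top_of_nonneg hγ.le Q.volume_toSet_ne_top
  have hlow : (((D + 1) / σ * M : ℝ≥0) : ℝ≥0∞) * (σ * volume Q.toSet ^ (1 - γ)) ≤
      (D * M : ℝ≥0) * volume Q.toSet ^ (1 - γ) := by
    calc (((D + 1) / σ * M : ℝ≥0) : ℝ≥0∞) * (σ * volume Q.toSet ^ (1 - γ))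
        = (((D + 1) / σ * M : ℝ≥0) : ℝ≥0∞) *
          (ENNReal.ofReal s * volume Q.toSet) ^ (1 - γ) := by
          rw [ENNReal.mul_rpow_of_nonneg _ _ hγ.le, hσ, ENNReal.ofReal,
            ENNReal.coe_rpow_of_nonneg _ hγ.le]
      _ ≤ _ := by gcongr
      _ ≤ C * ∫⁻ z in Q'.toSet, ‖f z‖ₑ := hw
      _ ≤ C * (2 * M * (volume Q'.toSet ^ (1 - γ) * l)) := by gcongr
      _ = _ := by
        rw [Q.volume_dyadicDilate 1, ENNReal.mul_rpow_of_nonneg _ _ hγ.le, hD]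
        push_cast [ENNReal.coe_rpow_of_nonneg _ hγ.le]
        rw [pow_one]
        ring
  rw [← mul_assoc, ENNReal.mul_le_mul_iff_left hvol0 hvolt] at hlow
  norm_cast at hlow
  have e : (D + 1) / σ * M * σ = D * M + M := by field_simp
  rw [e] at hlow
  exact absurd hlow (not_le.2 (lt_add_of_pos_right _ hM0))

end FracInt

theorem theorem2p2 {n : ℕ} {𝕜 : Type*} [RCLike 𝕜] (γ : ℝ) (hγ0 : 0 < γ) (hγ1 : γ < 1)
    (A : ℝ≥0 → ℝ≥0) (hA : FracInt.IsYoung A)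
    (k : (Fin n → ℝ) → (Fin n → ℝ) → 𝕜)
    (hk : AEStronglyMeasurable (Function.uncurry k) (volume.prod volume))
    (hweak : FracInt.IsWeakType k 1 (1 / (1 - γ)))
    (hhor : FracInt.IsHormander γ A k)
    (s : ℝ) (hs0 : 0 < s) (hs : s ≤ 1 / 2) :
    ∃ c : ℝ≥0, ∀ f : (Fin n → ℝ) → 𝕜, FracInt.InDomain k f →
      ∀ Q₀ : FracInt.Cube n, ∀ x ∈ Q₀.toSet,
        FracInt.localSharp s Q₀ (FracInt.intOp k f) x ≤
          c * ⨆ (Q : FracInt.Cube n) (_ : x ∈ Q.toSet) (_ : Q.toSet ⊆ Q₀.toSet),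
            ⨅ y ∈ Q.toSet,
              FracInt.fracMaximal γ (FracInt.conjugate A) f y := by
  obtain ⟨cA, hcA⟩ := hhor
  obtain ⟨K, hK0, hK⟩ := exists_volume_intOp_indicator_lt hγ1 hA hweak hs0
  refine ⟨K + 2 * cA, fun f hf Q₀ x hx => ?_⟩
  refine iSup_le fun Q => iSup_le fun hxQ => iSup_le fun hQ => ?_
  refine le_trans ?_ (mul_le_mul_right (le_iSup_of_le Q (le_iSup_of_le hxQ
    (le_iSup_of_le hQ le_rfl))) _)
  have hc0 : ((K + 2 * cA : ℝ≥0) : ℝ≥0∞) ≠ 0 := by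
    exact_mod_cast (by positivity : 0 < K + 2 * cA).ne'
  rw [← ENNReal.div_le_iff' hc0 ENNReal.coe_ne_top]
  -- A real `M` strictly above the infimum is positive even when the infimum is `0`, and some `y ∈
  -- Q` has maximal function below it.
  by_contra! hlt
  obtain ⟨M, hM, hMlt⟩ := ENNReal.lt_iff_exists_nnreal_btwn.1 hlt
  refine hMlt.not_ge ?_
  rw [ENNReal.div_le_iff' hc0 ENNReal.coe_ne_top]
  have hM0 : 0 < M := ENNReal.coe_pos.1 (bot_le.trans_lt hM)
  simp only [iInf_lt_iff] at hM
  obtain ⟨y, hy, hyM⟩ := hM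
  have hS := (Q.dyadicDilate 1).measurableSet_toSet
  have hkx : ∀ᵐ v, AEStronglyMeasurable (k v) volume := hk.prodMk_left
  -- Integrability and measurability of the kernel sections hold only almost everywhere, so `u` is
  -- drawn from `Q` by its positive measure and the level sets are compared up to null sets.
  have hgood := hf.2.and hkx
  obtain ⟨u, huQ, hu1, hu2⟩ : ∃ u ∈ Q.toSet, Integrable (fun y => k u y * f y) volume ∧
      AEStronglyMeasurable (k u) volume :=
    ((frequently_ae_mem_iff.2 Q.volume_toSet_ne_zero).and_eventually hgood).exists
  refine iInf_le_of_le (∫ z in (Q.dyadicDilate 1).toSetᶜ, k u z * f z)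
    (iInf_le_of_le (K * M + 2 * M * cA) (iInf_le_of_le ?_ ?_))
  · refine lt_of_le_of_lt (measure_mono_ae ?_) (hK f hf Q y hy M hM0 hyM.le)
    filter_upwards [hgood] with v hv hvα
    obtain ⟨hvQ, hvα⟩ := hvα
    have hfar : ‖(∫ z in (Q.dyadicDilate 1).toSetᶜ, k v z * f z) -
        ∫ z in (Q.dyadicDilate 1).toSetᶜ, k u z * f z‖ₑ ≤ ((2 * M * cA : ℝ≥0) : ℝ≥0∞) := by
      rw [← integral_sub hv.1.integrableOn hu1.integrableOn]
      refine (enorm_integral_le_lintegral_enorm _).trans ?_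
      simp only [← sub_mul, enorm_mul]
      exact_mod_cast lintegral_compl_kernel_sub_le hA.continuous (hcA Q v hvQ u huQ) hv.2 hu2 hy
        hyM.le
    rw [enorm_eq_nnnorm, ENNReal.coe_le_coe, ← NNReal.coe_le_coe, coe_nnnorm] at hfar
    rw [intOp_indicator_add_compl hv.1 hS, add_sub_assoc] at hvα
    have htri := norm_add_le (intOp k ((Q.dyadicDilate 1).toSet.indicator f) v)
      ((∫ z in (Q.dyadicDilate 1).toSetᶜ, k v z * f z) -
        ∫ z in (Q.dyadicDilate 1).toSetᶜ, k u z * f z)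
    rw [NNReal.coe_add] at hvα
    -- Removing the far oscillation, at most `2 M c_A`, from the level `α` leaves the local part
    -- above `K M`.
    exact lt_of_add_lt_add_right (hvα.trans_le (htri.trans (by gcongr)))
  · exact le_of_eq (by push_cast; ring)
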